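/- Let $\eta(z) = q^{1/24}\prod_{n=1}^{\infty}(1-q^n)$, where $q^{1/24} := e^{2\pi i z/24}$ and $q = e^{2\pi i z}$, be Dedekind's eta-function on the upper half-plane. For every prime $p$ and every even positive integer $k$, the function \[ z \longmapsto \frac{\eta(4pz)^{4k}}{\eta(2pz)^{2k}} \] belongs to $M_k(\Gamma_0(4p))$, the space of modular forms of weight $k$ (with trivial character, holomorphic on the upper half-plane and at all cusps) for $\Gamma_0(4p)$. -/

import Mathlib

namespace EtaQuotient

open Complex UpperHalfPlane Filter Topology ModularForm Matrix Matrix.SpecialLinearGroup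
open scoped Real MatrixGroups ModularForm Manifold

noncomputable section

/-! Since k = 2m, the function is the m-th power of η(4pz)^8/η(2pz)^4, which up to a constant is
θ₂^4 at 2pz. Under S and T the fourth powers of θ₂, θ₃, θ₄ are permuted up to sign, through SL(2,
ℤ/2) (`thetaOrbit_slash`). So θ₂^4 has weight 2 on Γ(2), and boundedness at every cusp reduces to
boundedness of these three at i∞. Finally, diag(2p, 1) conjugates Γ₀(4p) into Γ(2)
(`Gamma0_four_mul_le_conj`). -/

/-- The multiplier of `η` under `z ↦ z + 1`. -/
def etaMultiplier : ℂ := Function.Periodic.qParam 24 1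

lemma etaMultiplier_pow_twelve : etaMultiplier ^ 12 = -1 := by
  rw [etaMultiplier, Function.Periodic.qParam, ← Complex.exp_nat_mul, ← Complex.exp_pi_mul_I]
  congr 1
  push_cast
  ring

lemma eta_add_one (z : ℂ) : ModularForm.eta (z + 1) = etaMultiplier * ModularForm.eta z := by
  have h : Function.Periodic.qParam 1 (z + 1) = Function.Periodic.qParam 1 z := by
    simp [Function.Periodic.qParam, mul_add, Complex.exp_add]
  have h' : Function.Periodic.qParam 24 (z + 1) =
      etaMultiplier * Function.Periodic.qParam 24 z := by
    simp only [etaMultiplier, Function.Periodic.qParam, ← Complex.exp_add]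
    congr 1
    ring
  simp only [ModularForm.eta, ModularForm.eta_q, h, h', mul_assoc]

lemma eta_neg_inv_pow_four {z : ℂ} (hz : 0 < z.im) :
    ModularForm.eta (-1 / z) ^ 4 = -z ^ 2 * ModularForm.eta z ^ 4 := by
  have h := ModularForm.eta_comp_eq_csqrt_I_inv (x := z) hz
  have hsqrt : ∀ w : ℂ, w ≠ 0 → sqrt w ^ 4 = w ^ 2 := by
    intro w hw
    rw [sqrt_eq_exp hw, ← Complex.exp_nat_mul]
    rw [show ((4 : ℕ) : ℂ) * (Complex.log w / 2) = (2 : ℕ) * Complex.log w by push_cast; ring,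
      Complex.exp_nat_mul, Complex.exp_log hw]
  simp only [Function.comp_apply, Pi.smul_apply, Pi.mul_apply, smul_eq_mul] at h
  have hz0 : z ≠ 0 := by rintro rfl; simp at hz
  rw [h, mul_pow, mul_pow, inv_pow, hsqrt _ I_ne_zero, hsqrt _ hz0, I_sq]
  ring

lemma eta_neg_inv_pow_eight {z : ℂ} (hz : 0 < z.im) :
    ModularForm.eta (-1 / z) ^ 8 = z ^ 4 * ModularForm.eta z ^ 8 := by
  rw [show 8 = 4 * 2 from rfl, pow_mul, eta_neg_inv_pow_four hz]
  ring

lemma neg_one_div_im_pos {z : ℂ} (hz : 0 < z.im) : 0 < (-1 / z).im := by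
  simpa [neg_div, inv_neg] using UpperHalfPlane.im_inv_neg_coe_pos ⟨z, hz⟩

/-- The eighth power of `η` under the matrix `(1, -1; 2, -1)`. -/
lemma eta_pow_eight_elliptic {u : ℂ} (hu : 0 < u.im) :
    ModularForm.eta ((u - 1) / (2 * u - 1)) ^ 8 = (2 * u - 1) ^ 4 * ModularForm.eta u ^ 8 := by
  have hu0 : u ≠ 0 := by rintro rfl; simp at hu
  have hu1 : 2 * u - 1 ≠ 0 := by
    intro h
    have := congrArg Complex.im h
    simp at this
    exact hu.ne' this
  -- The matrix is T S T² S up to sign; its three translations contribute `etaMultiplier ^ 24 = 1`.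
  set v : ℂ := -1 / u + 1 + 1 with hv
  have hvim : 0 < v.im := by simpa [hv] using neg_one_div_im_pos hu
  have huv : v = (2 * u - 1) / u := by rw [hv]; field_simp; ring
  have hw : (u - 1) / (2 * u - 1) = -1 / v + 1 := by
    rw [huv, div_div_eq_mul_div, div_add_one hu1]
    ring
  rw [hw, eta_add_one, mul_pow, eta_neg_inv_pow_eight hvim, huv, ← huv, hv, eta_add_one,
    eta_add_one, mul_pow, mul_pow, eta_neg_inv_pow_eight hu, ← hv, huv]
  have h24 : etaMultiplier ^ 24 = 1 := by
    rw [show 24 = 12 * 2 from rfl, pow_mul, etaMultiplier_pow_twelve]; norm_num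
  field_simp
  linear_combination ModularForm.eta u ^ 8 * h24

/-! ### Eta quotients: holomorphy and growth at i∞ -/

/-- The quotient `η(az + b) ^ 8 / η(z) ^ 4`. -/
def etaQuot (a b : ℝ) (z : ℍ) : ℂ :=
  ModularForm.eta (a * z + b) ^ 8 / ModularForm.eta z ^ 4

lemma affine_im_pos {a : ℝ} (ha : 0 < a) (b : ℝ) {z : ℂ} (hz : 0 < z.im) :
    0 < ((a : ℂ) * z + b).im := by
  simpa using mul_pos ha hz

lemma mdifferentiable_etaQuot {a : ℝ} (ha : 0 < a) (b : ℝ) : MDiff (etaQuot a b) := by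
  rw [UpperHalfPlane.mdifferentiable_iff]
  have hd : DifferentiableOn ℂ (fun z : ℂ ↦ ModularForm.eta (a * z + b) ^ 8 /
      ModularForm.eta z ^ 4) {z | 0 < z.im} := by
    intro z hz
    refine DifferentiableAt.differentiableWithinAt (DifferentiableAt.div (.pow ?_ _)
      (.pow (differentiableAt_eta_of_mem_upperHalfPlaneSet hz) _)
      (pow_ne_zero _ (eta_ne_zero hz)))
    exact (differentiableAt_eta_of_mem_upperHalfPlaneSet (affine_im_pos ha b hz)).comp
      (f := fun z : ℂ ↦ (a : ℂ) * z + b) z (by fun_prop)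
  refine hd.congr fun z hz ↦ ?_
  simp [etaQuot, ofComplex_apply_of_im_pos hz]

lemma tendsto_tprod_one_sub_eta_q :
    Tendsto (fun z : ℂ ↦ ∏' n, (1 - eta_q n z)) (comap Complex.im atTop) (𝓝 1) := by
  have hc : ContinuousAt (fun q : ℂ ↦ ∏' n : ℕ, (1 - q ^ (n + 1))) 0 :=
    (differentiableOn_tprod_one_sub_pow.differentiableAt
      (Metric.isOpen_ball.mem_nhds (Metric.mem_ball_self one_pos))).continuousAt
  have := hc.tendsto.comp ((Function.Periodic.qParam_tendsto one_pos).mono_right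
    nhdsWithin_le_nhds)
  simpa [Function.comp_def] using this

/-- The leading term has modulus |q|^((2a - 1)/6), bounded exactly when a ≥ 1/2; the infinite
products tend to 1. -/
lemma isBoundedAtImInfty_etaQuot {a : ℝ} (ha : 1 / 2 ≤ a) (b : ℝ) :
    IsBoundedAtImInfty (etaQuot a b) := by
  have ha0 : 0 < a := by linarith
  have him : Tendsto (fun z : ℍ ↦ (z : ℂ).im) atImInfty atTop := tendsto_comap
  have hnum : Tendsto (fun z : ℍ ↦ ∏' n, (1 - eta_q n (a * z + b))) atImInfty (𝓝 1) := by
    refine tendsto_tprod_one_sub_eta_q.comp (f := fun z : ℍ ↦ (a * z + b : ℂ)) ?_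
    rw [tendsto_comap_iff]
    simpa [Function.comp_def] using him.const_mul_atTop ha0
  have hden : Tendsto (fun z : ℍ ↦ ∏' n, (1 - eta_q n z)) atImInfty (𝓝 1) :=
    tendsto_tprod_one_sub_eta_q.comp (tendsto_comap_iff.mpr him)
  have hquot := ((hnum.pow 8).div (hden.pow 4) (by simp)).isBigO_one ℝ
  have hq : (fun z : ℍ ↦ Function.Periodic.qParam 24 (a * z + b) ^ 8 /
      Function.Periodic.qParam 24 (z : ℂ) ^ 4) =O[atImInfty] (fun _ ↦ (1 : ℝ)) := by
    refine .of_bound 1 (.of_forall fun z ↦ ?_)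
    rw [norm_div, norm_pow, norm_pow, Function.Periodic.norm_qParam,
      Function.Periodic.norm_qParam, ← Real.exp_nat_mul, ← Real.exp_nat_mul, ← Real.exp_sub,
      norm_one, mul_one, Real.exp_le_one_iff]
    have hz : 0 < (z : ℂ).im := z.im_pos
    have h1 : ((a : ℂ) * z + b).im = a * (z : ℂ).im := by simp
    rw [h1]
    push_cast
    have : 0 ≤ π * (z : ℂ).im * (2 * a - 1) :=
      mul_nonneg (mul_pos Real.pi_pos hz).le (by linarith)
    linarith
  have := hq.mul hquot
  refine (this.congr (fun z ↦ ?_) (fun _ ↦ mul_one (1 : ℝ)))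
  simp only [etaQuot, ModularForm.eta, Pi.div_apply]
  rw [mul_pow, mul_pow, mul_div_mul_comm]

lemma coe_S_smul (z : ℍ) : ((ModularGroup.S • z : ℍ) : ℂ) = -1 / z := by
  rw [modular_S_smul]
  simp [neg_div, inv_neg]

lemma coe_T_smul (z : ℍ) : ((ModularGroup.T • z : ℍ) : ℂ) = z + 1 := by
  rw [modular_T_smul, coe_vadd]
  push_cast
  ring

lemma slash_S_apply (f : ℍ → ℂ) (z : ℍ) :
    (f ∣[(2 : ℤ)] ModularGroup.S) z = f (ModularGroup.S • z) / (z : ℂ) ^ 2 := by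
  rw [SL_slash_apply, ModularGroup.denom_S, _root_.zpow_neg, div_eq_mul_inv]
  rfl

lemma slash_T_apply (f : ℍ → ℂ) (z : ℍ) :
    (f ∣[(2 : ℤ)] ModularGroup.T) z = f (ModularGroup.T • z) := by
  rw [SL_slash_apply, ModularGroup.denom_apply]
  simp [ModularGroup.T]

/-! ### Fourth powers of theta constants under S and T -/

/-- The fourth power of `θ₂`, as the quotient `16 η(2z) ^ 8 / η(z) ^ 4`. -/
def thetaTwo : ℍ → ℂ := (16 : ℂ) • etaQuot 2 0

/-- The fourth power of `θ₄`, as the quotient `η(z / 2) ^ 8 / η(z) ^ 4`. -/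
def thetaFour : ℍ → ℂ := etaQuot (1 / 2) 0

/-- The fourth power of `θ₃`, as a multiple of `η((z + 1) / 2) ^ 8 / η(z) ^ 4`. -/
def thetaThree : ℍ → ℂ := (etaMultiplier ^ 4)⁻¹ • etaQuot (1 / 2) (1 / 2)

lemma etaMultiplier_ne_zero : etaMultiplier ≠ 0 := Function.Periodic.qParam_ne_zero _

lemma thetaTwo_slash_S : thetaTwo ∣[(2 : ℤ)] ModularGroup.S = -thetaFour := by
  ext z
  have hz : 0 < (z : ℂ).im := z.im_pos
  have hη := eta_ne_zero (z := z) hz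
  have hz2 : 0 < ((z : ℂ) / 2).im := by simpa using hz
  have h : (2 : ℂ) * (-1 / z) = -1 / (z / 2) := by field_simp [z.ne_zero]
  rw [slash_S_apply]
  simp only [thetaTwo, thetaFour, etaQuot, coe_S_smul, Pi.smul_apply, Pi.neg_apply, smul_eq_mul,
    ofReal_ofNat, ofReal_zero, add_zero, ofReal_div, ofReal_one, one_div_mul_eq_div]
  rw [h, eta_neg_inv_pow_four hz, eta_neg_inv_pow_eight hz2]
  field_simp [z.ne_zero]
  ring

lemma thetaFour_slash_S : thetaFour ∣[(2 : ℤ)] ModularGroup.S = -thetaTwo := by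
  ext z
  have hz : 0 < (z : ℂ).im := z.im_pos
  have hη := eta_ne_zero (z := z) hz
  have hz2 : 0 < (2 * (z : ℂ)).im := by simpa using hz
  have h : -1 / (z : ℂ) / 2 = -1 / (2 * z) := by field_simp [z.ne_zero]
  rw [slash_S_apply]
  simp only [thetaTwo, thetaFour, etaQuot, coe_S_smul, Pi.smul_apply, Pi.neg_apply, smul_eq_mul,
    ofReal_ofNat, ofReal_zero, add_zero, ofReal_div, ofReal_one, one_div_mul_eq_div]
  rw [h, eta_neg_inv_pow_four hz, eta_neg_inv_pow_eight hz2]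
  field_simp [z.ne_zero]
  ring

lemma thetaThree_slash_S : thetaThree ∣[(2 : ℤ)] ModularGroup.S = -thetaThree := by
  ext z
  have hz : 0 < (z : ℂ).im := z.im_pos
  have hη := eta_ne_zero (z := z) hz
  have hμ := etaMultiplier_ne_zero
  have hu : 0 < ((z : ℂ) / 2 + 1 / 2).im := by simpa using hz
  have h2 : 2 * ((z : ℂ) / 2 + 1 / 2) - 1 = z := by ring
  have h : -1 / (z : ℂ) / 2 + 1 / 2 =
      ((z : ℂ) / 2 + 1 / 2 - 1) / (2 * ((z : ℂ) / 2 + 1 / 2) - 1) := by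
    rw [h2]
    field_simp [z.ne_zero]
    ring
  rw [slash_S_apply]
  simp only [thetaThree, etaQuot, coe_S_smul, Pi.smul_apply, Pi.neg_apply, smul_eq_mul,
    ofReal_ofNat, ofReal_div, ofReal_one, one_div_mul_eq_div]
  rw [h, eta_neg_inv_pow_four hz, eta_pow_eight_elliptic hu, h2]
  field_simp [z.ne_zero]

lemma thetaTwo_slash_T : thetaTwo ∣[(2 : ℤ)] ModularGroup.T = -thetaTwo := by
  ext z
  have hη := eta_ne_zero (z := z) z.im_pos
  have hμ := etaMultiplier_ne_zero
  rw [slash_T_apply]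
  simp only [thetaTwo, etaQuot, coe_T_smul, Pi.smul_apply, Pi.neg_apply, smul_eq_mul,
    ofReal_ofNat, ofReal_zero, add_zero]
  rw [show (2 : ℂ) * (z + 1) = 2 * z + 1 + 1 by ring, eta_add_one, eta_add_one, eta_add_one]
  field_simp
  linear_combination ModularForm.eta (2 * z) ^ 8 * etaMultiplier_pow_twelve

lemma thetaFour_slash_T : thetaFour ∣[(2 : ℤ)] ModularGroup.T = thetaThree := by
  ext z
  have hη := eta_ne_zero (z := z) z.im_pos
  have hμ := etaMultiplier_ne_zero
  rw [slash_T_apply]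
  simp only [thetaFour, thetaThree, etaQuot, coe_T_smul, Pi.smul_apply, smul_eq_mul,
    ofReal_ofNat, ofReal_zero, add_zero, ofReal_div, ofReal_one, mul_add, mul_one]
  rw [eta_add_one]
  field_simp

lemma thetaThree_slash_T : thetaThree ∣[(2 : ℤ)] ModularGroup.T = thetaFour := by
  ext z
  have hη := eta_ne_zero (z := z) z.im_pos
  have hμ := etaMultiplier_ne_zero
  rw [slash_T_apply]
  simp only [thetaFour, thetaThree, etaQuot, coe_T_smul, Pi.smul_apply, smul_eq_mul,
    ofReal_ofNat, ofReal_zero, add_zero, ofReal_div, ofReal_one]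
  rw [show (1 : ℂ) / 2 * (z + 1) + 1 / 2 = 1 / 2 * z + 1 by ring, eta_add_one, eta_add_one]
  field_simp

/-! ### The action of SL(2, ℤ) modulo 2 -/

/-- The transforms of `thetaTwo` under `SL(2, ℤ)`, indexed by the reduction modulo `2`. -/
def thetaOrbit (N : SL(2, ZMod 2)) : ℍ → ℂ :=
  -- The bottom row selects the theta function, a top entry the sign.
  if N 1 0 = 0 then (if N 0 1 = 0 then thetaTwo else -thetaTwo)
  else if N 1 1 = 0 then (if N 0 0 = 0 then -thetaFour else thetaFour)
  else (if N 0 0 = 0 then -thetaThree else thetaThree)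

/-- Reduction modulo `2`. -/
abbrev redTwo : SL(2, ℤ) →* SL(2, ZMod 2) :=
  Matrix.SpecialLinearGroup.map (Int.castRingHom (ZMod 2))

lemma thetaOrbit_slash_S (N : SL(2, ZMod 2)) :
    thetaOrbit N ∣[(2 : ℤ)] ModularGroup.S = thetaOrbit (N * redTwo ModularGroup.S) := by
  have hdet := N.det_coe
  rw [Matrix.det_fin_two] at hdet
  have h2 : ∀ x : ZMod 2, x = 0 ∨ x = 1 := by decide
  rcases h2 (N 0 0) with h00 | h00 <;> rcases h2 (N 0 1) with h01 | h01 <;>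
  rcases h2 (N 1 0) with h10 | h10 <;> rcases h2 (N 1 1) with h11 | h11 <;>
  simp [h00, h01, h10, h11] at hdet <;>
  simp [thetaOrbit, h00, h01, h10, h11, Matrix.mul_apply, Fin.sum_univ_two, -Matrix.SpecialLinearGroup.map_apply_coe,
    SlashAction.neg_slash, CharTwo.add_self_eq_zero, thetaTwo_slash_S, thetaThree_slash_S, thetaFour_slash_S]

lemma thetaOrbit_slash_T (N : SL(2, ZMod 2)) :
    thetaOrbit N ∣[(2 : ℤ)] ModularGroup.T = thetaOrbit (N * redTwo ModularGroup.T) := by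
  have hdet := N.det_coe
  rw [Matrix.det_fin_two] at hdet
  have h2 : ∀ x : ZMod 2, x = 0 ∨ x = 1 := by decide
  rcases h2 (N 0 0) with h00 | h00 <;> rcases h2 (N 0 1) with h01 | h01 <;>
  rcases h2 (N 1 0) with h10 | h10 <;> rcases h2 (N 1 1) with h11 | h11 <;>
  simp [h00, h01, h10, h11] at hdet <;>
  simp [thetaOrbit, h00, h01, h10, h11, Matrix.mul_apply, Fin.sum_univ_two, -Matrix.SpecialLinearGroup.map_apply_coe,
    SlashAction.neg_slash, CharTwo.add_self_eq_zero, thetaTwo_slash_T, thetaThree_slash_T, thetaFour_slash_T]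

lemma thetaOrbit_slash (γ : SL(2, ℤ)) (N : SL(2, ZMod 2)) :
    thetaOrbit N ∣[(2 : ℤ)] γ = thetaOrbit (N * redTwo γ) := by
  have hγ : γ ∈ Subgroup.closure {ModularGroup.S, ModularGroup.T} := by
    simp [SpecialLinearGroup.SL2Z_generators]
  induction hγ using Subgroup.closure_induction generalizing N with
  | mem x hx =>
    rcases hx with rfl | rfl
    · exact thetaOrbit_slash_S N
    · exact thetaOrbit_slash_T N
  | one => simp
  | mul x y _ _ hx hy => rw [SlashAction.slash_mul, hx, hy, map_mul, mul_assoc]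
  | inv x _ hx =>
    -- The induction runs over all `N`, so it can be used at a shifted one.
    have := hx (N * redTwo x⁻¹)
    rw [mul_assoc, ← map_mul, inv_mul_cancel, map_one, mul_one] at this
    rw [← this, ← SlashAction.slash_mul, mul_inv_cancel, SlashAction.slash_one]

lemma thetaOrbit_one : thetaOrbit 1 = thetaTwo := by simp [thetaOrbit]

lemma thetaTwo_slash (γ : SL(2, ℤ)) : thetaTwo ∣[(2 : ℤ)] γ = thetaOrbit (redTwo γ) := by
  rw [← thetaOrbit_one, thetaOrbit_slash, one_mul]

lemma isBoundedAtImInfty_thetaOrbit (N : SL(2, ZMod 2)) :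
    IsBoundedAtImInfty (thetaOrbit N) := by
  have h2 : IsBoundedAtImInfty thetaTwo :=
    (isBoundedAtImInfty_etaQuot (by norm_num) _).const_smul_left _
  have h3 : IsBoundedAtImInfty thetaThree :=
    (isBoundedAtImInfty_etaQuot le_rfl _).const_smul_left _
  have h4 : IsBoundedAtImInfty thetaFour := isBoundedAtImInfty_etaQuot le_rfl _
  unfold thetaOrbit
  split_ifs
  exacts [h2, h2.neg_left, h4.neg_left, h4, h3.neg_left, h3]

/-! ### Modular forms on Γ(2) and Γ₀(4p) -/

/-- `θ₂ ^ 4` as a modular form of weight `2` for `Γ(2)`. -/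
def thetaTwoForm : ModularForm ((CongruenceSubgroup.Gamma 2).map (mapGL ℝ)) 2 where
  toFun := thetaTwo
  slash_action_eq' := by
    rintro _ ⟨γ, hγ, rfl⟩
    have hγ' : redTwo γ = 1 := CongruenceSubgroup.Gamma_mem'.mp hγ
    have := thetaTwo_slash γ
    rwa [hγ', thetaOrbit_one] at this
  holo' := (mdifferentiable_etaQuot two_pos 0).const_smul (16 : ℂ)
  bdd_at_cusps' hc := by
    -- Every cusp is an SL(2, ℤ)-translate of ∞, so all slashes are tested at i∞.
    rw [Subgroup.IsArithmetic.isCusp_iff_isCusp_SL2Z] at hc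
    rw [OnePoint.isBoundedAt_iff_forall_SL2Z hc]
    intro γ _
    rw [thetaTwo_slash]
    exact isBoundedAtImInfty_thetaOrbit _

/-- The restriction of a modular form to a smaller group. -/
def restrictLevel {Γ Γ' : Subgroup (GL (Fin 2) ℝ)} {k : ℤ} (h : Γ' ≤ Γ) (f : ModularForm Γ k) :
    ModularForm Γ' k where
  toFun := f
  slash_action_eq' γ hγ := f.slash_action_eq' γ (h hγ)
  holo' := f.holo'
  bdd_at_cusps' hc := f.bdd_at_cusps' (hc.mono h)

/-- The matrix of `z ↦ rz`. -/
def scaleMatrix (r : ℝ) (hr : 0 < r) : GL (Fin 2) ℝ :=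
  Matrix.GeneralLinearGroup.mkOfDetNeZero !![r, 0; 0, 1] (by simpa using hr.ne')

lemma slash_scaleMatrix_apply (f : ℍ → ℂ) {r : ℝ} (hr : 0 < r) (z : ℍ) :
    (f ∣[(2 : ℤ)] scaleMatrix r hr) z = r * f ⟨r * z, by simpa using mul_pos hr z.im_pos⟩ := by
  have hdet : (scaleMatrix r hr).det.val = r := by
    simp [scaleMatrix, Matrix.GeneralLinearGroup.mkOfDetNeZero]
  have hpos : 0 < (scaleMatrix r hr).det.val := hr.trans_eq hdet.symm
  have hden : denom (scaleMatrix r hr) z = 1 := by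
    simp [denom, scaleMatrix, Matrix.GeneralLinearGroup.mkOfDetNeZero]
  have hsmul : scaleMatrix r hr • z = ⟨r * z, by simpa using mul_pos hr z.im_pos⟩ := by
    ext
    rw [coe_smul_of_det_pos hpos, hden]
    simp [num, scaleMatrix, Matrix.GeneralLinearGroup.mkOfDetNeZero]
  rw [slash_apply, hden, hdet, hsmul, UpperHalfPlane.σ, if_pos hpos]
  simp [abs_of_pos hr]
  ring

open ConjAct Pointwise in
lemma Gamma0_four_mul_le_conj {p : ℕ} (hp : 0 < (2 * p : ℝ)) :
    (CongruenceSubgroup.Gamma0 (4 * p)).map (mapGL ℝ) ≤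
      toConjAct (scaleMatrix (2 * p) hp)⁻¹ •
        (CongruenceSubgroup.Gamma 2).map (mapGL ℝ) := by
  rintro _ ⟨γ, hγ, rfl⟩
  rw [map_inv, Subgroup.mem_inv_pointwise_smul_iff, toConjAct_smul]
  have hγ' : ((γ 1 0 : ℤ) : ZMod (4 * p)) = 0 := hγ
  obtain ⟨c, hc⟩ := (ZMod.intCast_zmod_eq_zero_iff_dvd _ _).mp hγ'
  push_cast at hc
  have hdet := γ.det_coe
  rw [Matrix.det_fin_two, hc] at hdet
  -- From ad = 1 + 4pbc, both diagonal entries are odd.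
  have hodd : Odd (γ 0 0 * γ 1 1) := ⟨2 * (γ 0 1 * (p * c)), by linear_combination hdet⟩
  rw [Int.odd_mul] at hodd
  let γ' : SL(2, ℤ) := ⟨!![γ 0 0, 2 * p * γ 0 1; 2 * c, γ 1 1], by
    rw [Matrix.det_fin_two_of]; linear_combination hdet⟩
  refine ⟨γ', ?_, ?_⟩
  · have h2 : (2 : ZMod 2) = 0 := rfl
    refine CongruenceSubgroup.Gamma_mem.mpr ⟨?_, ?_, ?_, ?_⟩
    · simpa [γ', ZMod.intCast_eq_one_iff_odd] using hodd.1
    · simp [γ', h2]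
    · simp [γ', h2]
    · simpa [γ', ZMod.intCast_eq_one_iff_odd] using hodd.2
  · rw [eq_mul_inv_iff_mul_eq]
    have hc' : ((γ 1 0 : ℤ) : ℝ) = 4 * p * c := by rw [hc]; push_cast; ring
    have h00 : γ' 0 0 = γ 0 0 := rfl
    have h01 : γ' 0 1 = 2 * p * γ 0 1 := rfl
    have h10 : γ' 1 0 = 2 * c := rfl
    have h11 : γ' 1 1 = γ 1 1 := rfl
    ext i j
    fin_cases i <;> fin_cases j <;>
    simp [h00, h01, h10, h11, scaleMatrix, Matrix.GeneralLinearGroup.mkOfDetNeZero, Matrix.mul_apply,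
      Fin.sum_univ_two, hc'] <;> ring

/-- The form `η(4pz) ^ 8 / η(2pz) ^ 4` of weight `2` for `Γ₀(4p)`. -/
def weightTwoForm (p : ℕ) (hp : 0 < (2 * p : ℝ)) :
    ModularForm ((CongruenceSubgroup.Gamma0 (4 * p)).map (mapGL ℝ)) 2 :=
  -- Cancels the 16 in `thetaTwo` and the determinant factor 2p of the weight 2 slash.
  ((16 * (2 * p) : ℂ)⁻¹) •
    restrictLevel (Gamma0_four_mul_le_conj hp) (translate thetaTwoForm (scaleMatrix (2 * p) hp))

lemma weightTwoForm_apply (p : ℕ) (hp : 0 < (2 * p : ℝ)) (z : ℍ) :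
    weightTwoForm p hp z =
      ModularForm.eta (4 * p * z) ^ 8 / ModularForm.eta (2 * p * z) ^ 4 := by
  have hp0 : (p : ℂ) ≠ 0 := by
    rintro h
    rw [Nat.cast_eq_zero] at h
    simp [h] at hp
  have h : weightTwoForm p hp z =
      (16 * (2 * p) : ℂ)⁻¹ * (thetaTwo ∣[(2 : ℤ)] scaleMatrix (2 * p) hp) z := rfl
  rw [h, slash_scaleMatrix_apply]
  simp only [thetaTwo, etaQuot, Pi.smul_apply, smul_eq_mul, ofReal_ofNat, ofReal_zero, add_zero,
    ofReal_mul, ofReal_natCast]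
  rw [show (2 : ℂ) * (2 * p * z) = 4 * p * z by ring]
  field_simp

end

end EtaQuotient

theorem mainTheorem9 (p : ℕ) (hp : p.Prime) (k : ℕ) (hk : 0 < k) (hk_even : Even k) :
    ∃ f : ModularForm
        ((CongruenceSubgroup.Gamma0 (4 * p)).map (Matrix.SpecialLinearGroup.mapGL ℝ)) (k : ℤ),
      ∀ z : UpperHalfPlane,
        f z = ModularForm.eta (4 * (p : ℂ) * (z : ℂ)) ^ (4 * k) /
          ModularForm.eta (2 * (p : ℂ) * (z : ℂ)) ^ (2 * k) := by
  obtain ⟨m, rfl⟩ := hk_even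
  have hp' : 0 < (2 * p : ℝ) := mul_pos two_pos (Nat.cast_pos.mpr hp.pos)
  refine ⟨((EtaQuotient.weightTwoForm p hp').pow m).mcast (by push_cast; ring), fun z ↦ ?_⟩
  rw [ModularForm.mcast_apply, ModularForm.coe_pow, Pi.pow_apply,
    EtaQuotient.weightTwoForm_apply, div_pow, ← pow_mul, ← pow_mul]
  ring_nf
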